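/- **Theorem.** Let $[a_1,\dots,a_n]$ be a positive continued fraction, that is, $n\ge 1$ and every $a_i$ is a positive integer. Let $C[a_1,\dots,a_n]$ be the associated 2-bridge link, given by the alternating 4-plat diagram with a 2-strand braid of $a_1$ crossings on the two middle strands, then one of $a_2$ crossings on the two left strands, then one of $a_3$ crossings on the two middle strands, and so on. The chirality is such that a crossing of the first braid is negative whenever its two strands run in parallel (so $C[3]$ is the trefoil with Jones polynomial $t^{-1}+t^{-3}-t^{-4}$). Give $C[a_1,\dots,a_n]$ any orientation (one exists) and let $V=V_{[a_1,\dots,a_n]}\in\mathbb Z[t^{1/2},t^{-1/2}]$ be its Jones polynomial, normalized by $V(\text{unknot})=1$ and $t^{-1}V(L_+)-t\,V(L_-)+(t^{-1/2}-t^{1/2})V(L_0)=0$. Put $q=-t^{-1}$, $[b]_q=1+q+\dots+q^{b-1}$, $\ell_i=a_1+\dots+a_i$, and $$\mathcal L_1=[a_1+1]_q-q,\qquad \mathcal L_i=[a_i]_q\,q^{-\ell_i}\ \ (i\ge 2\text{ even}),\qquad \mathcal L_i=[a_i]_q\,q^{\ell_{i-1}+1}\ \ (i\ge 3\text{ odd}).$$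 Let $N[\mathcal L_1,\dots,\mathcal L_n]$ be the numerator of the continued fraction $[\mathcal L_1,\dots,\mathcal L_n]$, defined by $N[\,]=1$, $N[\mathcal L_1]=\mathcal L_1$ and $N[\mathcal L_1,\dots,\mathcal L_k]=\mathcal L_k\,N[\mathcal L_1,\dots,\mathcal L_{k-1}]+N[\mathcal L_1,\dots,\mathcal L_{k-2}]$ for $k\ge2$. Then the leading term of $V$ (the term with the highest exponent of $t$) is $\delta\,t^{j}$ for some $\delta\in\{1,-1\}$ and $j\in\tfrac12\mathbb Z$, and $$V=\delta\,t^{j}\,N[\mathcal L_1,\dots,\mathcal L_n]\ \text{ if } n \text{ is odd},\qquad V=\delta\,t^{j}\,q^{\ell_n}\,N[\mathcal L_1,\dots,\mathcal L_n]\ \text{ if } n\text{ is even}.$$ -/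

import Mathlib

open LaurentPolynomial

noncomputable section

namespace TwoBridge

/-! ### The coefficient ring

Everything lives in `ℤ[t^{1/4}, t^{-1/4}]`, realised as `ℤ[T;T⁻¹]` with `T 1 = t^{1/4}`.  Thus
`T (2 * j) = t^{j/2}` and `T 4 = t`. -/

/-- The power `t^{k/4}` as a unit of `ℤ[t^{±1/4}]`. -/
def tQuarter (k : ℤ) : ℤ[T;T⁻¹]ˣ where
  val := T k
  inv := T (-k)
  val_inv := by rw [← T_add, add_neg_cancel, T_zero]
  inv_val := by rw [← T_add, neg_add_cancel, T_zero]

/-- The variable of the Kauffman bracket, `A = t^{-1/4}`. -/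
def A : ℤ[T;T⁻¹]ˣ := tQuarter (-1)

/-- `q = -t⁻¹`, as a unit, so that it has integer powers. -/
def q : ℤ[T;T⁻¹]ˣ := -tQuarter (-4)

/-- `f` has leading term `c · T^d`: the highest exponent that occurs in `f` is `d`, and its
coefficient is `c`. -/
def IsLeadingTerm (f : ℤ[T;T⁻¹]) (c d : ℤ) : Prop :=
  c ≠ 0 ∧ f.coeff d = c ∧ ∀ e, d < e → f.coeff e = 0

/-! ### Link diagrams

A link diagram is drawn in the plane so that its height function is generic.  Mark finitely many
points on the curves, at which the tangent is not horizontal, so that these cut the diagram into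
elementary pieces: local extrema (an arc that joins two marked points and has one local maximum or
one local minimum), and crossings of two monotone strands (an "X" with four marked ends).
Every marked point belongs to exactly two pieces. -/

/-- A crossing with its four ends: north-west, north-east, south-west, south-east.  One strand runs
from `nw` to `se`, the other one from `ne` to `sw`; the latter is the overstrand
if and only if `overNE = true`. -/
structure Crossing where
  nw : ℕ
  ne : ℕ
  sw : ℕ
  se : ℕ
  overNE : Bool

/-- The combinatorial data of a link diagram: the marked points are `0, …, points - 1`. -/
structure LinkDiagram where
  points : ℕ
  extrema : List (ℕ × ℕ)
  crossings : List Crossing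

namespace Crossing

/-- The smoothing of a crossing into two vertical arcs. -/
def vertical (c : Crossing) : List (ℕ × ℕ) := [(c.nw, c.sw), (c.ne, c.se)]

/-- The smoothing of a crossing into two horizontal arcs (a local minimum above a local maximum). -/
def horizontal (c : Crossing) : List (ℕ × ℕ) := [(c.nw, c.ne), (c.sw, c.se)]

/-- The `A`-smoothing: it opens a channel between the two regions that are swept out when the
overstrand is turned counterclockwise until it meets the understrand. -/
def smoothA (c : Crossing) : List (ℕ × ℕ) := if c.overNE then c.vertical else c.horizontal

/-- The `B`-smoothing: the other one. -/
def smoothB (c : Crossing) : List (ℕ × ℕ) := if c.overNE then c.horizontal else c.vertical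

/-- The sign of a crossing of an oriented diagram; `o x = true` means that the strand points upwards
at the marked point `x`.  If both strands go up (or both down), the crossing is positive exactly
when the overstrand is the one that runs between south-west and north-east; reversing one of the
strands changes the sign. -/
def sign (c : Crossing) (o : ℕ → Bool) : ℤ := if c.overNE = (o c.nw == o c.ne) then 1 else -1

end Crossing

/-- The number of closed curves that are formed by the arcs in `J` between the points
`0, …, m - 1`, i.e. the number of connected components of the graph with these points as vertices
and the arcs in `J` as edges. -/
def loops (m : ℕ) (J : List (ℕ × ℕ)) : ℕ :=
  Nat.card (Quot fun x y : Fin m => ((x : ℕ), (y : ℕ)) ∈ J)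

/-- The Kauffman bracket of the diagram with marked points `0, …, m - 1`, given crossings and
given arcs `J` without crossings:
`⟨D⟩ = A ⟨A-smoothing of D⟩ + A⁻¹ ⟨B-smoothing of D⟩` at every crossing, and `k` disjoint closed
curves without crossings have bracket `(-A² - A⁻²)^(k - 1)`. -/
def bracketAux (m : ℕ) : List Crossing → List (ℕ × ℕ) → ℤ[T;T⁻¹]
  | [], J => (-((A ^ 2 : ℤ[T;T⁻¹]ˣ) : ℤ[T;T⁻¹]) - ((A ^ (-2 : ℤ) : ℤ[T;T⁻¹]ˣ) : ℤ[T;T⁻¹]))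
      ^ (loops m J - 1)
  | c :: cs, J => (A : ℤ[T;T⁻¹]) * bracketAux m cs (c.smoothA ++ J)
      + ((A⁻¹ : ℤ[T;T⁻¹]ˣ) : ℤ[T;T⁻¹]) * bracketAux m cs (c.smoothB ++ J)

namespace LinkDiagram

/-- The Kauffman bracket of an unoriented link diagram, normalised to be `1` on a circle. -/
def bracket (D : LinkDiagram) : ℤ[T;T⁻¹] := bracketAux D.points D.crossings D.extrema

/-- `o` (with `o x = true` for "upwards at the marked point `x`") is an orientation of the link:
the vertical direction is reversed along a local extremum and kept along each of the two strands of
a crossing. -/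
def IsOrientation (D : LinkDiagram) (o : ℕ → Bool) : Prop :=
  (∀ e ∈ D.extrema, o e.1 ≠ o e.2) ∧
    ∀ c ∈ D.crossings, o c.nw = o c.se ∧ o c.ne = o c.sw

/-- The writhe: the sum of the signs of the crossings. -/
def writhe (D : LinkDiagram) (o : ℕ → Bool) : ℤ :=
  (D.crossings.map fun c => c.sign o).sum

/-- The Jones polynomial of the link with diagram `D` and orientation `o`, that is
`(-A³)^(-writhe) ⟨D⟩` at `A = t^{-1/4}`.  It is `1` for the unknot and satisfies
`t⁻¹ V(L₊) - t V(L₋) + (t^{-1/2} - t^{1/2}) V(L₀) = 0`. -/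
def jones (D : LinkDiagram) (o : ℕ → Bool) : ℤ[T;T⁻¹] :=
  (((-A ^ 3) ^ (-D.writhe o) : ℤ[T;T⁻¹]ˣ) : ℤ[T;T⁻¹]) * D.bracket

end LinkDiagram

/-! ### Two-bridge links -/

/-- A diagram under construction from top to bottom, with four strands that still hang down from it:
`s1, s2, s3, s4` are their lower ends, from left to right, and `next` is the first unused label for
a marked point. -/
structure Partial where
  next : ℕ
  s1 : ℕ
  s2 : ℕ
  s3 : ℕ
  s4 : ℕ
  crossings : List Crossing

namespace Partial

/-- Two local maxima side by side, with legs `0, 1` and `2, 3`. -/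
def start : Partial := ⟨4, 0, 1, 2, 3, []⟩

/-- Add a crossing between the second and the third strand, in which the overstrand goes from
north-west to south-east. -/
def twistMiddle (P : Partial) : Partial :=
  { P with
    next := P.next + 2
    s2 := P.next
    s3 := P.next + 1
    crossings := ⟨P.s2, P.s3, P.next, P.next + 1, false⟩ :: P.crossings }

/-- Add a crossing between the first and the second strand, in which the overstrand goes from
north-east to south-west. -/
def twistLeft (P : Partial) : Partial :=
  { P with
    next := P.next + 2
    s1 := P.next
    s2 := P.next + 1
    crossings := ⟨P.s1, P.s2, P.next, P.next + 1, true⟩ :: P.crossings }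

end Partial

/-- The first `n` two-strand braids of the two-bridge diagram: `a 1` crossings of the two middle
strands, then `a 2` crossings of the two left strands, then `a 3` crossings of the two middle
strands, and so on.  The two kinds of crossings are opposite, so the diagram is alternating. -/
def braids (a : ℕ → ℕ) : ℕ → Partial
  | 0 => Partial.start
  | n + 1 => (if Even n then Partial.twistMiddle else Partial.twistLeft)^[a (n + 1)] (braids a n)

/-- The standard alternating diagram of the two-bridge link `C[a 1, …, a n]`: the four strands are
closed below the last braid by two local minima, side by side if `n` is odd and nested if `n`
is even. -/
def twoBridge (a : ℕ → ℕ) (n : ℕ) : LinkDiagram :=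
  let P := braids a n
  { points := P.next
    extrema := [(0, 1), (2, 3)] ++
      if Odd n then [(P.s1, P.s2), (P.s3, P.s4)] else [(P.s2, P.s3), (P.s1, P.s4)]
    crossings := P.crossings }

/-! ### Continued fractions -/

/-- The numerator `N[x 1, …, x n]` of a continued fraction, through
`N[x 1, …, x n] = x n * N[x 1, …, x (n-1)] + N[x 1, …, x (n-2)]`. -/
def numerator {R : Type*} [CommRing R] (x : ℕ → R) : ℕ → R
  | 0 => 1
  | 1 => x 1
  | n + 2 => x (n + 2) * numerator x (n + 1) + numerator x n

/-- The `q`-analogue `[b]_q = 1 + q + ⋯ + q^(b-1)`. -/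
def qNum (b : ℕ) : ℤ[T;T⁻¹] := ∑ i ∈ Finset.range b, (q : ℤ[T;T⁻¹]) ^ i

/-- `ℓ_i = a 1 + ⋯ + a i`. -/
def ell (a : ℕ → ℕ) (i : ℕ) : ℕ := ∑ k ∈ Finset.Icc 1 i, a k

/-- The `i`-th entry of the continued fraction of Laurent polynomials (for `i ≥ 1`). -/
def entry (a : ℕ → ℕ) (i : ℕ) : ℤ[T;T⁻¹] :=
  if i = 1 then qNum (a 1 + 1) - (q : ℤ[T;T⁻¹])
  else if Even i then qNum (a i) * ((q ^ (-(ell a i : ℤ)) : ℤ[T;T⁻¹]ˣ) : ℤ[T;T⁻¹])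
  else qNum (a i) * ((q ^ ((ell a (i - 1) : ℤ) + 1) : ℤ[T;T⁻¹]ˣ) : ℤ[T;T⁻¹])

end TwoBridge

end

open TwoBridge

/-! The four strands hanging from a partial diagram are closed in two ways, with Kauffman brackets S
(side by side) and N (nested). Both smoothings of the lowest crossing give closures of the diagram
above it, so a twist acts linearly on (S, N). A middle twist puts a kink into the nested closure,
which contributes a unit, and replaces S by A N + A⁻¹ S; a left twist does the same with the roles
of the closures exchanged. A braid of k crossings thus multiplies one bracket by a unit and adds to
the other a unit times [k]_q times the first (`Partial.iterate_twistMiddle`,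
`Partial.iterate_twistLeft`). As the two kinds of braids alternate, this is the three-term recursion
of continued fraction numerators: up to units, S and N are always two consecutive numerators
(`braids_bracket`). The powers of q in the entries are the quotients of these units.

The Jones polynomial is the bracket times a unit ±A^k, so it has the required form up to a sign and
a power of t^{1/4}. The writhe has the parity of the number of crossings, which makes the exponent a
multiple of 1/2 (`jones_eq`). The same recursion shows that the normalised numerator is a polynomial
in q with constant term 1 (`exists_numerator_eq`); since q = -t⁻¹, its leading term in t is 1, and
the prefactor is the leading term of V.

An orientation exists because the strands of a partial diagram match its lower ends in pairs, and
either closure is compatible with each of the three possible matchings (`Partial.Paired`). -/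

noncomputable section

namespace TwoBridge

/-! ### Counting closed curves -/

/-- The points `x` and `y` are connected by the arcs in `J` between the points `0, …, m - 1`. -/
def Joined (m : ℕ) (J : List (ℕ × ℕ)) (x y : ℕ) : Prop :=
  ∃ (hx : x < m) (hy : y < m),
    Quot.mk (fun x y : Fin m => ((x : ℕ), (y : ℕ)) ∈ J) ⟨x, hx⟩ = Quot.mk _ ⟨y, hy⟩

namespace Joined

variable {m : ℕ} {J : List (ℕ × ℕ)} {x y z : ℕ}

theorem refl (hx : x < m) : Joined m J x x := ⟨hx, hx, rfl⟩

theorem symm (h : Joined m J x y) : Joined m J y x := by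
  obtain ⟨hx, hy, h⟩ := h
  exact ⟨hy, hx, h.symm⟩

theorem trans (h : Joined m J x y) (h' : Joined m J y z) : Joined m J x z := by
  obtain ⟨hx, hy, h⟩ := h
  obtain ⟨hy', hz, h'⟩ := h'
  exact ⟨hx, hz, h.trans h'⟩

theorem of_mem (hx : x < m) (hy : y < m) (h : (x, y) ∈ J) : Joined m J x y :=
  ⟨hx, hy, Quot.sound h⟩

theorem of_mem' (hx : x < m) (hy : y < m) (h : (y, x) ∈ J) : Joined m J x y :=
  (of_mem hy hx h).symm

end Joined

theorem card_quot_eq {α γ : Type*} {r : α → α → Prop} (F : α → γ)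
    (hF : ∀ x y, r x y → F x = F y) (G : γ → Quot r) (hGF : ∀ x, G (F x) = Quot.mk r x)
    (hFG : ∀ c, Quot.lift F hF (G c) = c) : Nat.card (Quot r) = Nat.card γ :=
  Nat.card_congr ⟨Quot.lift F hF, G, fun x => by
    induction x using Quot.ind with
    | mk x => exact hGF x, hFG⟩

/-- The retraction `f` and the inclusion of the smaller set of points induce mutually inverse maps
on components. -/
theorem loops_eq_of_retraction {m m' : ℕ} {J J' : List (ℕ × ℕ)} (hm : m ≤ m') (f : ℕ → ℕ)
    (hf : ∀ x < m', f x < m) (hJ : ∀ x y, x < m' → y < m' → (x, y) ∈ J → Joined m J' (f x) (f y))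
    (hJ' : ∀ x y, x < m → y < m → (x, y) ∈ J' → Joined m' J x y)
    (h1 : ∀ x < m', Joined m' J (f x) x) (h2 : ∀ x < m, f x = x) :
    loops m' J = loops m J' := by
  refine card_quot_eq (fun x : Fin m' => Quot.mk _ (⟨f x, hf x x.2⟩ : Fin m)) ?_
    (Quot.lift (fun x : Fin m => Quot.mk _ (⟨x, x.2.trans_le hm⟩ : Fin m')) ?_) ?_ ?_
  · intro x y hxy
    exact (hJ x y x.2 y.2 hxy).2.2
  · intro x y hxy
    exact (hJ' x y x.2 y.2 hxy).2.2
  · intro x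
    exact (h1 x x.2).2.2
  · intro c
    induction c using Quot.ind with
    | mk x => simp only [h2 x x.2]

/-- No arc connects the two new points with the old ones, so they form exactly one extra component,
the `none` of an `Option`. -/
theorem loops_add_circle {m : ℕ} {J J' : List (ℕ × ℕ)} (h : Joined (m + 2) J m (m + 1))
    (hJ : ∀ x y, x < m + 2 → y < m + 2 → (x, y) ∈ J → x < m ∧ y < m ∧ Joined m J' x y ∨
      m ≤ x ∧ m ≤ y)
    (hJ' : ∀ x y, x < m → y < m → (x, y) ∈ J' → Joined (m + 2) J x y) :
    loops (m + 2) J = loops m J' + 1 := by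
  have key : loops (m + 2) J =
      Nat.card (Option (Quot fun x y : Fin m => ((x : ℕ), (y : ℕ)) ∈ J')) := by
    refine card_quot_eq
      (fun x : Fin (m + 2) => if hx : (x : ℕ) < m then some (Quot.mk _ ⟨x, hx⟩) else none) ?_
      (fun c => c.elim (Quot.mk _ ⟨m, by omega⟩)
        (Quot.lift (fun x : Fin m => Quot.mk _ (⟨x, by omega⟩ : Fin (m + 2))) ?_)) ?_ ?_
    · intro x y hxy
      rcases hJ x y x.2 y.2 hxy with ⟨hx, hy, _, _, hq⟩ | ⟨hx, hy⟩
      · simp only [hx, hy, dif_pos, hq]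
      · simp only [hx.not_gt, hy.not_gt, dif_neg, not_false_iff]
    · intro x y hxy
      exact (hJ' x y x.2 y.2 hxy).2.2
    · intro x
      by_cases hx : (x : ℕ) < m
      · simp [hx]
      · simp only [hx, dif_neg, not_false_iff, Option.elim_none]
        obtain ⟨x, hx'⟩ := x
        obtain rfl | rfl : x = m ∨ x = m + 1 := by simp at hx; omega
        · rfl
        · exact h.2.2
    · intro c
      cases c with
      | none => simp
      | some c =>
        induction c using Quot.ind with
        | mk x => simp
  rw [key, Finite.card_option]
  rfl

/-! ### Removing the two lowest points from a bracket -/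

/-- The value of an additional circle in the Kauffman bracket. -/
def circleValue : ℤ[T;T⁻¹] :=
  -((A ^ 2 : ℤ[T;T⁻¹]ˣ) : ℤ[T;T⁻¹]) - ((A ^ (-2 : ℤ) : ℤ[T;T⁻¹]ˣ) : ℤ[T;T⁻¹])

/-- All the ends of arcs in `J` are below `m`. -/
def ArcsBelow (m : ℕ) (J : List (ℕ × ℕ)) : Prop := ∀ x y, (x, y) ∈ J → x < m ∧ y < m

theorem ArcsBelow.append {m : ℕ} {J J' : List (ℕ × ℕ)} (h : ArcsBelow m J)
    (h' : ArcsBelow m J') : ArcsBelow m (J ++ J') := fun x y hxy =>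
  (List.mem_append.1 hxy).elim (h x y) (h' x y)

/-- All the ends of the crossings in `cs` are below `m`. -/
def CrossingsBelow (m : ℕ) (cs : List Crossing) : Prop :=
  ∀ c ∈ cs, c.nw < m ∧ c.ne < m ∧ c.sw < m ∧ c.se < m

theorem arcsBelow_smooth {m : ℕ} {c : Crossing}
    (h : c.nw < m ∧ c.ne < m ∧ c.sw < m ∧ c.se < m) :
    ArcsBelow m c.smoothA ∧ ArcsBelow m c.smoothB := by
  constructor <;> intro x y hxy <;>
    simp only [Crossing.smoothA, Crossing.smoothB, Crossing.vertical, Crossing.horizontal] at hxy <;>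
    split_ifs at hxy <;> simp at hxy <;> omega

/-- The bracket is a sum over the smoothings of `cs`, and the change of arcs alters each state by
the same ε circles. Quantifying over `J0` lets the induction absorb the arcs of each smoothing. -/
theorem bracketAux_reduce {m k : ℕ} (hm : 0 < m) (ε : ℕ) {cs : List Crossing}
    (hcs : CrossingsBelow m cs) {J J' : List (ℕ × ℕ)}
    (h : ∀ J0, ArcsBelow m J0 → loops k (J0 ++ J) = loops m (J0 ++ J') + ε) :
    bracketAux k cs J = circleValue ^ ε * bracketAux m cs J' := by
  induction cs generalizing J J' with
  | nil =>
    have h0 := h [] (by intro x y hxy; simp at hxy)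
    simp only [List.nil_append] at h0
    -- The exponent `loops - 1` is a truncated subtraction, so ε factors split off only if there is
    -- at least one loop.
    have : 0 < loops m J' := by
      have : Nonempty (Quot fun x y : Fin m => ((x : ℕ), (y : ℕ)) ∈ J') := ⟨Quot.mk _ ⟨0, hm⟩⟩
      exact Nat.card_pos
    rw [bracketAux, bracketAux, h0, ← circleValue, ← pow_add]
    congr 1
    omega
  | cons c cs ih =>
    have hc := arcsBelow_smooth (hcs c (by simp))
    have hcs' : CrossingsBelow m cs := fun c' hc' => hcs c' (by simp [hc'])
    have step : ∀ S, ArcsBelow m S →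
        bracketAux k cs (S ++ J) = circleValue ^ ε * bracketAux m cs (S ++ J') := by
      intro S hS
      refine ih hcs' fun J0 hJ0 => ?_
      simpa only [List.append_assoc] using h (J0 ++ S) (hJ0.append hS)
    rw [bracketAux, bracketAux, step _ hc.1, step _ hc.2]
    ring

/-- The map that moves `m` to `x`, `m + 1` to `y`, and keeps all other points. -/
def redirect (m x y z : ℕ) : ℕ := if z = m then x else if z = m + 1 then y else z

theorem redirect_of_lt {m x y z : ℕ} (hz : z < m) : redirect m x y z = z := by
  simp only [redirect]
  split_ifs <;> omega

@[simp] theorem redirect_self {m x y : ℕ} : redirect m x y m = x := by simp [redirect]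

@[simp] theorem redirect_self_succ {m x y : ℕ} : redirect m x y (m + 1) = y := by simp [redirect]

theorem redirect_lt {m x y z : ℕ} (hx : x < m) (hy : y < m) (hz : z < m + 2) :
    redirect m x y z < m := by
  simp only [redirect]
  split_ifs <;> omega

theorem joined_redirect {m x y : ℕ} {J : List (ℕ × ℕ)} (hx : Joined (m + 2) J x m)
    (hy : Joined (m + 2) J y (m + 1)) {z : ℕ} (hz : z < m + 2) :
    Joined (m + 2) J (redirect m x y z) z := by
  obtain rfl | rfl | h : z = m ∨ z = m + 1 ∨ z < m := by omega
  · simpa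
  · simpa
  · rw [redirect_of_lt h]
    exact .refl hz

theorem loops_redirect {m x y : ℕ} {J J' : List (ℕ × ℕ)} (hx : x < m) (hy : y < m)
    (hxJ : Joined (m + 2) J x m) (hyJ : Joined (m + 2) J y (m + 1))
    (hJ : ∀ z w, z < m + 2 → w < m + 2 → (z, w) ∈ J →
      Joined m J' (redirect m x y z) (redirect m x y w))
    (hJ' : ∀ z w, z < m → w < m → (z, w) ∈ J' → Joined (m + 2) J z w) :
    loops (m + 2) J = loops m J' :=
  loops_eq_of_retraction (by omega) (redirect m x y) (fun _ hz => redirect_lt hx hy hz) hJ hJ'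
    (fun _ hz => joined_redirect hxJ hyJ hz) (fun _ hz => redirect_of_lt hz)

/-- Two vertical arcs that end in `m` and `m + 1` can be shrunk. -/
theorem loops_vertical {m u v : ℕ} (hu : u < m) (hv : v < m) {J E : List (ℕ × ℕ)}
    (hJ : ArcsBelow m J) (hE : ArcsBelow (m + 2) E) :
    loops (m + 2) (J ++ ([(u, m), (v, m + 1)] ++ E)) =
      loops m (J ++ E.map (Prod.map (redirect m u v) (redirect m u v))) := by
  have hxJ : Joined (m + 2) (J ++ ([(u, m), (v, m + 1)] ++ E)) u m :=
    .of_mem (by omega) (by omega) (by simp)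
  have hyJ : Joined (m + 2) (J ++ ([(u, m), (v, m + 1)] ++ E)) v (m + 1) :=
    .of_mem (by omega) (by omega) (by simp)
  refine loops_redirect hu hv hxJ hyJ ?_ ?_
  · intro z w hz hw h
    simp only [List.mem_append, List.mem_cons, List.not_mem_nil, or_false, Prod.mk.injEq] at h
    rcases h with h | (⟨rfl, rfl⟩ | ⟨rfl, rfl⟩) | h
    · obtain ⟨h1, h2⟩ := hJ _ _ h
      rw [redirect_of_lt h1, redirect_of_lt h2]
      exact .of_mem h1 h2 (by simp [h])
    · rw [redirect_of_lt hu, redirect_self]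
      exact .refl hu
    · rw [redirect_of_lt hv, redirect_self_succ]
      exact .refl hv
    · refine .of_mem (redirect_lt hu hv hz) (redirect_lt hu hv hw) (List.mem_append_right _ ?_)
      exact List.mem_map.2 ⟨_, h, rfl⟩
  · intro z w hz hw h
    rcases List.mem_append.1 h with h | h
    · exact .of_mem (by omega) (by omega) (by simp [h])
    · obtain ⟨⟨z', w'⟩, hzw, he⟩ := List.mem_map.1 h
      obtain ⟨rfl, rfl⟩ := Prod.mk.inj he
      obtain ⟨h1, h2⟩ := hE _ _ hzw
      exact ((joined_redirect hxJ hyJ h1).trans (.of_mem h1 h2 (by simp [hzw]))).trans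
        (joined_redirect hxJ hyJ h2).symm

/-- A horizontal arc between `m` and `m + 1` that continues to `x` and `y` can be shrunk. -/
theorem loops_horizontal {m u v x y : ℕ} (hu : u < m) (hv : v < m) (hx : x < m) (hy : y < m)
    {J E F : List (ℕ × ℕ)} (hJ : ArcsBelow m J)
    (hE : E = [(x, m), (m + 1, y)] ∧ F = [(x, y)] ∨ E = [(m + 1, y), (m, x)] ∧ F = [(y, x)]) :
    loops (m + 2) (J ++ ([(u, v), (m, m + 1)] ++ E)) = loops m (J ++ ([(u, v)] ++ F)) := by
  have hxJ : Joined (m + 2) (J ++ ([(u, v), (m, m + 1)] ++ E)) x m := by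
    rcases hE with ⟨rfl, rfl⟩ | ⟨rfl, rfl⟩
    · exact .of_mem (by omega) (by omega) (by simp)
    · exact .of_mem' (by omega) (by omega) (by simp)
  have hyJ : Joined (m + 2) (J ++ ([(u, v), (m, m + 1)] ++ E)) y (m + 1) := by
    rcases hE with ⟨rfl, rfl⟩ | ⟨rfl, rfl⟩ <;>
      exact .of_mem' (by omega) (by omega) (by simp)
  have hxy : Joined (m + 2) (J ++ ([(u, v), (m, m + 1)] ++ E)) x y :=
    (hxJ.trans (.of_mem (by omega) (by omega) (by simp))).trans hyJ.symm
  have hxy' : Joined m (J ++ ([(u, v)] ++ F)) x y := by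
    rcases hE with ⟨rfl, rfl⟩ | ⟨rfl, rfl⟩
    · exact .of_mem hx hy (by simp)
    · exact .of_mem' hx hy (by simp)
  refine loops_redirect hx hy hxJ hyJ ?_ ?_
  · intro z w hz hw h
    simp only [List.mem_append, List.mem_cons, List.not_mem_nil, or_false, Prod.mk.injEq] at h
    rcases h with h | (⟨rfl, rfl⟩ | ⟨rfl, rfl⟩) | h
    · obtain ⟨h1, h2⟩ := hJ _ _ h
      rw [redirect_of_lt h1, redirect_of_lt h2]
      exact .of_mem h1 h2 (by simp [h])
    · rw [redirect_of_lt hu, redirect_of_lt hv]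
      exact .of_mem hu hv (by simp)
    · rwa [redirect_self, redirect_self_succ]
    · rcases hE with ⟨rfl, -⟩ | ⟨rfl, -⟩ <;>
        simp only [List.mem_cons, List.not_mem_nil, or_false, Prod.mk.injEq] at h <;>
        obtain ⟨rfl, rfl⟩ | ⟨rfl, rfl⟩ := h <;>
        simp only [redirect_of_lt hx, redirect_of_lt hy, redirect_self, redirect_self_succ] <;>
        first | exact .refl hx | exact .refl hy
  · intro z w hz hw h
    simp only [List.mem_append, List.mem_cons, List.not_mem_nil, or_false, Prod.mk.injEq] at h
    rcases h with h | ⟨rfl, rfl⟩ | h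
    · exact .of_mem (by omega) (by omega) (by simp [h])
    · exact .of_mem (by omega) (by omega) (by simp)
    · rcases hE with ⟨-, rfl⟩ | ⟨-, rfl⟩ <;>
        simp only [List.mem_cons, List.not_mem_nil, or_false, Prod.mk.injEq] at h <;>
        obtain ⟨rfl, rfl⟩ := h
      · exact hxy
      · exact hxy.symm

/-- Two horizontal arcs between `m` and `m + 1` form a circle. -/
theorem loops_circle {m u v : ℕ} (hu : u < m) (hv : v < m) {J E : List (ℕ × ℕ)}
    (hJ : ArcsBelow m J) (hE : ArcsBelow m E) :
    loops (m + 2) (J ++ ([(u, v), (m, m + 1)] ++ ([(m, m + 1)] ++ E))) =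
      loops m (J ++ ([(u, v)] ++ E)) + 1 := by
  refine loops_add_circle (.of_mem (by omega) (by omega) (by simp)) ?_ ?_
  · intro z w hz hw h
    simp only [List.mem_append, List.mem_cons, List.not_mem_nil, or_false, Prod.mk.injEq] at h
    have below : z < m ∧ w < m ∧ (z, w) ∈ J ++ ([(u, v)] ++ E) → z < m ∧ w < m ∧
        Joined m (J ++ ([(u, v)] ++ E)) z w ∨ m ≤ z ∧ m ≤ w := fun ⟨h1, h2, h3⟩ =>
      .inl ⟨h1, h2, .of_mem h1 h2 h3⟩
    rcases h with h | (⟨rfl, rfl⟩ | ⟨rfl, rfl⟩) | ⟨rfl, rfl⟩ | h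
    · exact below ⟨(hJ _ _ h).1, (hJ _ _ h).2, by simp [h]⟩
    · exact below ⟨hu, hv, by simp⟩
    · right; omega
    · right; omega
    · exact below ⟨(hE _ _ h).1, (hE _ _ h).2, by simp [h]⟩
  · intro z w hz hw h
    simp only [List.mem_append, List.mem_cons, List.not_mem_nil, or_false, Prod.mk.injEq] at h
    refine .of_mem (by omega) (by omega) ?_
    rcases h with h | ⟨rfl, rfl⟩ | h <;> simp [*]

/-! ### The bracket of a partial diagram under its two closures -/

namespace Partial

/-- All the labels that are used in the partial diagram are below `next`. -/
structure WellFormed (P : Partial) : Prop where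
  four_le : 4 ≤ P.next
  lt1 : P.s1 < P.next
  lt2 : P.s2 < P.next
  lt3 : P.s3 < P.next
  lt4 : P.s4 < P.next
  crossings : CrossingsBelow P.next P.crossings

/-- The bracket of the diagram closed by two minima side by side. -/
def sideBracket (P : Partial) : ℤ[T;T⁻¹] :=
  bracketAux P.next P.crossings ([(0, 1), (2, 3)] ++ [(P.s1, P.s2), (P.s3, P.s4)])

/-- The bracket of the diagram closed by two nested minima. -/
def nestedBracket (P : Partial) : ℤ[T;T⁻¹] :=
  bracketAux P.next P.crossings ([(0, 1), (2, 3)] ++ [(P.s2, P.s3), (P.s1, P.s4)])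

theorem wellFormed_start : start.WellFormed := by
  constructor <;> simp [start, CrossingsBelow]

theorem WellFormed.twistMiddle {P : Partial} (h : P.WellFormed) : P.twistMiddle.WellFormed := by
  obtain ⟨h0, h1, h2, h3, h4, h5⟩ := h
  constructor <;> simp only [Partial.twistMiddle] <;> try omega
  intro c hc
  rcases List.mem_cons.1 hc with rfl | hc
  · dsimp only; omega
  · have := h5 c hc; omega

theorem WellFormed.twistLeft {P : Partial} (h : P.WellFormed) : P.twistLeft.WellFormed := by
  obtain ⟨h0, h1, h2, h3, h4, h5⟩ := h
  constructor <;> simp only [Partial.twistLeft] <;> try omega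
  intro c hc
  rcases List.mem_cons.1 hc with rfl | hc
  · dsimp only; omega
  · have := h5 c hc; omega

theorem arcsBelow_maxima {m : ℕ} (h : 4 ≤ m) : ArcsBelow m [(0, 1), (2, 3)] := by
  intro x y hxy
  simp at hxy
  omega

/-- The vertical smoothing removes the crossing: the new ends are merely extensions of `u` and `v`.
-/
theorem bracketAux_vertical {P : Partial} (h : P.WellFormed) {u v : ℕ} (hu : u < P.next)
    (hv : v < P.next) {E F : List (ℕ × ℕ)} (hE : ArcsBelow (P.next + 2) E)
    (hF : E.map (Prod.map (redirect P.next u v) (redirect P.next u v)) = F) :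
    bracketAux (P.next + 2) P.crossings
        ([(u, P.next), (v, P.next + 1)] ++ ([(0, 1), (2, 3)] ++ E)) =
      bracketAux P.next P.crossings ([(0, 1), (2, 3)] ++ F) := by
  have hm : ArcsBelow (P.next + 2) [(0, 1), (2, 3)] :=
    arcsBelow_maxima (by have := h.four_le; omega)
  rw [bracketAux_reduce (by have := h.four_le; omega) 0 h.crossings
    (J' := [(0, 1), (2, 3)] ++ F), pow_zero, one_mul]
  intro J hJ
  rw [loops_vertical hu hv hJ (hm.append hE), List.map_append, hF, add_zero]
  have h4 := h.four_le
  simp [redirect_of_lt (show 0 < P.next by omega), redirect_of_lt (show 1 < P.next by omega),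
    redirect_of_lt (show 2 < P.next by omega), redirect_of_lt (show 3 < P.next by omega)]

/-- Only membership of arcs matters. This moves the two maxima `K` to the arcs that a reduction
leaves untouched. -/
theorem loops_append_comm (m : ℕ) (J S K E : List (ℕ × ℕ)) :
    loops m (J ++ (S ++ (K ++ E))) = loops m ((J ++ K) ++ (S ++ E)) := by
  have : ∀ p, p ∈ J ++ (S ++ (K ++ E)) ↔ p ∈ (J ++ K) ++ (S ++ E) := by
    intro p
    simp only [List.mem_append]
    tauto
  simp only [loops, this]

theorem bracketAux_horizontal {P : Partial} (h : P.WellFormed) {u v x y : ℕ} (hu : u < P.next)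
    (hv : v < P.next) (hx : x < P.next) (hy : y < P.next) {E F : List (ℕ × ℕ)}
    (hE : E = [(x, P.next), (P.next + 1, y)] ∧ F = [(x, y)] ∨
      E = [(P.next + 1, y), (P.next, x)] ∧ F = [(y, x)]) :
    bracketAux (P.next + 2) P.crossings
        ([(u, v), (P.next, P.next + 1)] ++ ([(0, 1), (2, 3)] ++ E)) =
      bracketAux P.next P.crossings ([(0, 1), (2, 3)] ++ ([(u, v)] ++ F)) := by
  have hm := arcsBelow_maxima h.four_le
  rw [bracketAux_reduce (by have := h.four_le; omega) 0 h.crossings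
    (J' := [(0, 1), (2, 3)] ++ ([(u, v)] ++ F)), pow_zero, one_mul]
  intro J hJ
  rw [loops_append_comm, loops_horizontal hu hv hx hy (hJ.append hm) hE, add_zero,
    List.append_assoc J]

theorem bracketAux_circle {P : Partial} (h : P.WellFormed) {u v : ℕ} (hu : u < P.next)
    (hv : v < P.next) {E : List (ℕ × ℕ)} (hE : ArcsBelow P.next E) :
    bracketAux (P.next + 2) P.crossings
        ([(u, v), (P.next, P.next + 1)] ++ ([(0, 1), (2, 3)] ++ ([(P.next, P.next + 1)] ++ E))) =
      circleValue * bracketAux P.next P.crossings ([(0, 1), (2, 3)] ++ ([(u, v)] ++ E)) := by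
  have hm := arcsBelow_maxima h.four_le
  rw [bracketAux_reduce (by have := h.four_le; omega) 1 h.crossings
    (J' := [(0, 1), (2, 3)] ++ ([(u, v)] ++ E)), pow_one]
  intro J hJ
  rw [loops_append_comm, loops_circle hu hv (hJ.append hm) hE, List.append_assoc J]

variable {P : Partial}

/-- The horizontal smoothing joins the second and third strands, and its lower arc links the two
minima into one: the nested closure. -/
theorem sideBracket_twistMiddle (h : P.WellFormed) :
    P.twistMiddle.sideBracket =
      (A : ℤ[T;T⁻¹]) * P.nestedBracket + ((A⁻¹ : ℤ[T;T⁻¹]ˣ) : ℤ[T;T⁻¹]) * P.sideBracket := by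
  obtain ⟨h0, h1, h2, h3, h4, h5⟩ := id h
  have e1 := bracketAux_horizontal h h2 h3 h1 h4 (.inl ⟨rfl, rfl⟩)
  have e2 := bracketAux_vertical h h2 h3 (E := [(P.s1, P.next), (P.next + 1, P.s4)])
    (F := [(P.s1, P.s2), (P.s3, P.s4)]) (by intro x y hxy; simp at hxy; omega)
    (by simp [redirect_of_lt h1, redirect_of_lt h4])
  rw [sideBracket, twistMiddle, bracketAux]
  simp only [Crossing.smoothA, Crossing.smoothB, Crossing.vertical, Crossing.horizontal,
    Bool.false_eq_true, if_false]
  rw [e1, e2]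
  rfl

/-- Here the crossing is a kink: the inner minimum closes the lower arc of the horizontal smoothing
to a circle. -/
theorem nestedBracket_twistMiddle (h : P.WellFormed) :
    P.twistMiddle.nestedBracket = (A : ℤ[T;T⁻¹]) * (circleValue * P.nestedBracket) +
      ((A⁻¹ : ℤ[T;T⁻¹]ˣ) : ℤ[T;T⁻¹]) * P.nestedBracket := by
  obtain ⟨h0, h1, h2, h3, h4, h5⟩ := id h
  have e1 := bracketAux_circle h h2 h3 (E := [(P.s1, P.s4)])
    (by intro x y hxy; simp at hxy; omega)
  have e2 := bracketAux_vertical h h2 h3 (E := [(P.next, P.next + 1), (P.s1, P.s4)])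
    (F := [(P.s2, P.s3), (P.s1, P.s4)]) (by intro x y hxy; simp at hxy; omega)
    (by simp [redirect_of_lt h1, redirect_of_lt h4])
  rw [nestedBracket, twistMiddle, bracketAux]
  simp only [Crossing.smoothA, Crossing.smoothB, Crossing.vertical, Crossing.horizontal,
    Bool.false_eq_true, if_false]
  rw [e2]
  exact congrArg (fun z => _ * z + _) e1

theorem nestedBracket_twistLeft (h : P.WellFormed) :
    P.twistLeft.nestedBracket =
      (A : ℤ[T;T⁻¹]) * P.nestedBracket + ((A⁻¹ : ℤ[T;T⁻¹]ˣ) : ℤ[T;T⁻¹]) * P.sideBracket := by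
  obtain ⟨h0, h1, h2, h3, h4, h5⟩ := id h
  -- The nested closure lists the arc at `next + 1` first; the second alternative keeps this order,
  -- so that the result is literally the side closure.
  have e1 := bracketAux_horizontal h h1 h2 h4 h3 (.inr ⟨rfl, rfl⟩)
  have e2 := bracketAux_vertical h h1 h2 (E := [(P.next + 1, P.s3), (P.next, P.s4)])
    (F := [(P.s2, P.s3), (P.s1, P.s4)]) (by intro x y hxy; simp at hxy; omega)
    (by simp [redirect_of_lt h3, redirect_of_lt h4])
  rw [nestedBracket, twistLeft, bracketAux]
  simp only [Crossing.smoothA, Crossing.smoothB, Crossing.vertical, Crossing.horizontal, if_true]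
  rw [e1, e2]
  rfl

theorem sideBracket_twistLeft (h : P.WellFormed) :
    P.twistLeft.sideBracket = (A : ℤ[T;T⁻¹]) * P.sideBracket +
      ((A⁻¹ : ℤ[T;T⁻¹]ˣ) : ℤ[T;T⁻¹]) * (circleValue * P.sideBracket) := by
  obtain ⟨h0, h1, h2, h3, h4, h5⟩ := id h
  have e1 := bracketAux_circle h h1 h2 (E := [(P.s3, P.s4)])
    (by intro x y hxy; simp at hxy; omega)
  have e2 := bracketAux_vertical h h1 h2 (E := [(P.next, P.next + 1), (P.s3, P.s4)])
    (F := [(P.s1, P.s2), (P.s3, P.s4)]) (by intro x y hxy; simp at hxy; omega)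
    (by simp [redirect_of_lt h3, redirect_of_lt h4])
  rw [sideBracket, twistLeft, bracketAux]
  simp only [Crossing.smoothA, Crossing.smoothB, Crossing.vertical, Crossing.horizontal, if_true]
  rw [e2]
  exact congrArg (fun z => _ + _ * z) e1

theorem loops_four_side : loops 4 [(0, 1), (2, 3), (0, 1), (2, 3)] = 2 := by
  rw [loops_add_circle (m := 2) (J' := [(0, 1)]) (.of_mem (by omega) (by omega) (by simp))]
  · rw [loops_add_circle (m := 0) (J' := []) (.of_mem (by omega) (by omega) (by simp))]
    · simp [loops]
    · intro x y _ _ hxy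
      simp at hxy
      omega
    · intro x y hx
      omega
  · intro x y _ _ hxy
    simp at hxy
    rcases hxy with ⟨rfl, rfl⟩ | ⟨rfl, rfl⟩ | ⟨rfl, rfl⟩ | ⟨rfl, rfl⟩
    · exact .inl ⟨by omega, by omega, .of_mem (by omega) (by omega) (by simp)⟩
    · right; omega
    · exact .inl ⟨by omega, by omega, .of_mem (by omega) (by omega) (by simp)⟩
    · right; omega
  · intro x y _ _ hxy
    simp at hxy
    obtain ⟨rfl, rfl⟩ := hxy
    exact .of_mem (by omega) (by omega) (by simp)

theorem loops_four_nested : loops 4 [(0, 1), (2, 3), (1, 2), (0, 3)] = 1 := by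
  rw [loops, Nat.card_eq_one_iff_unique]
  have key : ∀ x : Fin 4, Joined 4 [(0, 1), (2, 3), (1, 2), (0, 3)] x 0 := by
    have h1 : Joined 4 [(0, 1), (2, 3), (1, 2), (0, 3)] 1 0 :=
      .of_mem' (by omega) (by omega) (by simp)
    have h3 : Joined 4 [(0, 1), (2, 3), (1, 2), (0, 3)] 3 0 :=
      .of_mem' (by omega) (by omega) (by simp)
    have h2 : Joined 4 [(0, 1), (2, 3), (1, 2), (0, 3)] 2 3 :=
      .of_mem (by omega) (by omega) (by simp)
    intro x
    fin_cases x
    · exact .refl (by omega)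
    · exact h1
    · exact h2.trans h3
    · exact h3
  refine ⟨⟨fun x y => ?_⟩, ⟨Quot.mk _ 0⟩⟩
  induction x using Quot.ind with
  | mk x =>
    induction y using Quot.ind with
    | mk y => exact ((key x).trans (key y).symm).2.2

theorem sideBracket_start : start.sideBracket = circleValue := by
  simp only [sideBracket, start, bracketAux, List.cons_append, List.nil_append, loops_four_side]
  exact pow_one _

theorem nestedBracket_start : start.nestedBracket = 1 := by
  simp only [nestedBracket, start, bracketAux, List.cons_append, List.nil_append,
    loops_four_nested]
  exact pow_zero _

end Partial

/-! ### Powers of `A` and `q` -/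

/-- The power `A ^ z` as a Laurent polynomial. -/
def aPow (z : ℤ) : ℤ[T;T⁻¹] := ((A ^ z : ℤ[T;T⁻¹]ˣ) : ℤ[T;T⁻¹])

/-- The power `q ^ z` as a Laurent polynomial. -/
def qPow (z : ℤ) : ℤ[T;T⁻¹] := ((q ^ z : ℤ[T;T⁻¹]ˣ) : ℤ[T;T⁻¹])

theorem aPow_add (y z : ℤ) : aPow (y + z) = aPow y * aPow z := by simp [aPow, zpow_add]

theorem qPow_add (y z : ℤ) : qPow (y + z) = qPow y * qPow z := by simp [qPow, zpow_add]

theorem aPow_mul {x y z : ℤ} (h : x + y = z) : aPow x * aPow y = aPow z := by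
  rw [← h, aPow_add]

theorem qPow_natCast (k : ℕ) : qPow k = (q : ℤ[T;T⁻¹]) ^ k := by simp [qPow]

theorem tQuarter_pow (k : ℤ) (z : ℤ) : tQuarter k ^ z = tQuarter (k * z) := by
  have add : ∀ y z, tQuarter (y + z) = tQuarter y * tQuarter z := fun y z => Units.ext (T_add y z)
  induction z using Int.induction_on with
  | zero => exact Units.ext (by simp [tQuarter])
  | succ i ih => rw [zpow_add_one, ih, mul_add, mul_one, add]
  | pred i ih =>
    rw [zpow_sub_one, ih, mul_sub, mul_one, mul_inv_eq_iff_eq_mul, ← add, sub_add_cancel]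

theorem aPow_eq (z : ℤ) : aPow z = T (-z) := by
  rw [aPow, A, tQuarter_pow, neg_one_mul]
  rfl

theorem neg_zpow_eq (u : ℤ[T;T⁻¹]ˣ) (z : ℤ) :
    (((-u) ^ z : ℤ[T;T⁻¹]ˣ) : ℤ[T;T⁻¹]) =
      C (((-1 : ℤˣ) ^ z : ℤˣ) : ℤ) * ((u ^ z : ℤ[T;T⁻¹]ˣ) : ℤ[T;T⁻¹]) := by
  rw [neg_eq_neg_one_mul, mul_zpow, Units.val_mul]
  congr 1
  rcases Int.even_or_odd z with h | h
  · rw [h.neg_one_zpow, h.neg_one_zpow]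
    simp
  · rw [h.neg_one_zpow, h.neg_one_zpow]
    simp

theorem qPow_eq (z : ℤ) : qPow z = C (((-1 : ℤˣ) ^ z : ℤˣ) : ℤ) * T (-4 * z) := by
  rw [qPow, q, neg_zpow_eq, tQuarter_pow]
  rfl

theorem qPow_one : qPow 1 = -aPow 4 := by
  rw [qPow_eq, aPow_eq]
  simp

theorem qPow_neg_one : qPow (-1) = -aPow (-4) := by
  rw [qPow_eq, aPow_eq]
  simp

theorem circleValue_eq : circleValue = -aPow 2 - aPow (-2) := rfl

theorem qNum_succ (k : ℕ) : qNum (k + 1) = qNum k + qPow k := by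
  rw [qNum, Finset.sum_range_succ, qPow_natCast]
  rfl

/-! ### The brackets of two-strand braids -/

namespace Partial

variable {P : Partial}

/-- The kink factor is A(-A² - A⁻²) + A⁻¹ = -A³, which is A⁻¹q because q = -A⁴. -/
theorem nestedBracket_twistMiddle' (h : P.WellFormed) :
    P.twistMiddle.nestedBracket = aPow (-1) * qPow 1 * P.nestedBracket := by
  have hA : (A : ℤ[T;T⁻¹]) = aPow 1 := by simp [aPow]
  have hA' : ((A⁻¹ : ℤ[T;T⁻¹]ˣ) : ℤ[T;T⁻¹]) = aPow (-1) := by simp [aPow]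
  rw [nestedBracket_twistMiddle h, hA, hA', circleValue_eq, qPow_one]
  linear_combination P.nestedBracket * (aPow_mul (show (-1 : ℤ) + 4 = 3 by rfl)
    - aPow_mul (show (1 : ℤ) + 2 = 3 by rfl) - aPow_mul (show (1 : ℤ) + -2 = -1 by rfl))

theorem sideBracket_twistLeft' (h : P.WellFormed) :
    P.twistLeft.sideBracket = aPow 1 * qPow (-1) * P.sideBracket := by
  have hA : (A : ℤ[T;T⁻¹]) = aPow 1 := by simp [aPow]
  have hA' : ((A⁻¹ : ℤ[T;T⁻¹]ˣ) : ℤ[T;T⁻¹]) = aPow (-1) := by simp [aPow]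
  rw [sideBracket_twistLeft h, hA, hA', circleValue_eq, qPow_neg_one]
  linear_combination P.sideBracket * (aPow_mul (show (1 : ℤ) + -4 = -3 by rfl)
    - aPow_mul (show (-1 : ℤ) + 2 = 1 by rfl) - aPow_mul (show (-1 : ℤ) + -2 = -3 by rfl))

/-- After i twists the nested bracket carries q^i, so the contributions to the side bracket add up
to the geometric sum [k]_q. -/
theorem iterate_twistMiddle (h : P.WellFormed) (k : ℕ) :
    (twistMiddle^[k] P).WellFormed ∧
    (twistMiddle^[k] P).nestedBracket = aPow (-k) * qPow k * P.nestedBracket ∧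
    (twistMiddle^[k] P).sideBracket =
      aPow (-k) * (P.sideBracket + aPow 2 * qNum k * P.nestedBracket) := by
  induction k with
  | zero => simp [h, aPow, qPow, qNum]
  | succ k ih =>
    obtain ⟨hw, hn, hs⟩ := ih
    have hA : (A : ℤ[T;T⁻¹]) = aPow 1 := by simp [aPow]
    have hA' : ((A⁻¹ : ℤ[T;T⁻¹]ˣ) : ℤ[T;T⁻¹]) = aPow (-1) := by simp [aPow]
    have e : aPow (-(k + 1 : ℕ)) = aPow (-k) * aPow (-1) := by
      rw [← aPow_add]; congr 1; push_cast; ring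
    rw [Function.iterate_succ_apply']
    refine ⟨hw.twistMiddle, ?_, ?_⟩
    · rw [nestedBracket_twistMiddle' hw, hn, e, Nat.cast_succ, qPow_add]
      ring
    · rw [sideBracket_twistMiddle hw, hn, hs, e, qNum_succ, hA, hA']
      linear_combination -aPow (-k) * qPow k * P.nestedBracket *
        aPow_mul (show (-1 : ℤ) + 2 = 1 by rfl)

/-- The kink factor is now A q⁻¹, so the geometric sum runs over powers of q⁻¹; it equals q^(1-k)
[k]_q. -/
theorem iterate_twistLeft (h : P.WellFormed) (k : ℕ) :
    (twistLeft^[k] P).WellFormed ∧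
    (twistLeft^[k] P).sideBracket = aPow k * qPow (-k) * P.sideBracket ∧
    (twistLeft^[k] P).nestedBracket =
      aPow k * (P.nestedBracket + aPow (-2) * qPow (1 - k) * qNum k * P.sideBracket) := by
  induction k with
  | zero => simp [h, aPow, qPow, qNum]
  | succ k ih =>
    obtain ⟨hw, hs, hn⟩ := ih
    have hA : (A : ℤ[T;T⁻¹]) = aPow 1 := by simp [aPow]
    have hA' : ((A⁻¹ : ℤ[T;T⁻¹]ˣ) : ℤ[T;T⁻¹]) = aPow (-1) := by simp [aPow]
    have hnum : qNum (k + 1) = 1 + qPow 1 * qNum k := by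
      rw [qNum, Finset.sum_range_succ', qNum, Finset.mul_sum, add_comm, pow_zero]
      simp only [qPow, zpow_one, pow_succ']
    have e1 : qPow (1 - (k + 1 : ℕ)) = qPow (-k) := by congr 1; push_cast; ring
    have e2 : qPow (-(k + 1 : ℕ)) = qPow (-k) * qPow (-1) := by
      rw [← qPow_add]; congr 1; push_cast; ring
    have e3 : qPow (1 - k) = qPow (-k) * qPow 1 := by
      rw [← qPow_add]; congr 1; ring
    have e4 : aPow (-1) = aPow 1 * aPow (-2) := by rw [← aPow_add]; rfl
    rw [Function.iterate_succ_apply']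
    refine ⟨hw.twistLeft, ?_, ?_⟩
    · rw [sideBracket_twistLeft' hw, hs, e2, Nat.cast_succ, aPow_add]
      ring
    · rw [nestedBracket_twistLeft hw, hn, hs, hnum, hA, hA', e1, e3, e4, Nat.cast_succ, aPow_add]
      ring

end Partial

/-! ### The brackets of two-bridge diagrams -/

theorem ell_succ (a : ℕ → ℕ) (n : ℕ) : ell a (n + 1) = ell a n + a (n + 1) := by
  rw [ell, ell, Finset.sum_Icc_succ_top (by omega)]

/-- The side bracket carries the numerator of the largest odd index up to n + 1, the nested bracket
that of the largest even one. The exponents e and o are the sums of the `a i` with even and odd i.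
The parity of z is kept for the exponent of the Jones polynomial. -/
theorem braids_bracket (a : ℕ → ℕ) (n : ℕ) :
    (braids a (n + 1)).WellFormed ∧ ∃ z e o : ℤ, e + o = ell a (n + 1) ∧
      Even (z + ell a (n + 1)) ∧
      (braids a (n + 1)).sideBracket =
        aPow (z + 2) * qPow (-1 - e) * numerator (entry a) (if Even n then n + 1 else n) ∧
      (braids a (n + 1)).nestedBracket =
        aPow z * qPow o * numerator (entry a) (if Even n then n else n + 1) := by
  induction n with
  | zero =>
    obtain ⟨hw, hn, hs⟩ := Partial.iterate_twistMiddle Partial.wellFormed_start (a 1)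
    refine ⟨hw, -(a 1 : ℤ), 0, a 1, by simp [ell], by simp [ell], ?_, ?_⟩
    · have e1 : qNum (a 1 + 1) = 1 + qPow 1 * qNum (a 1) := by
        rw [qNum, Finset.sum_range_succ', qNum, Finset.mul_sum, add_comm, pow_zero]
        simp only [qPow, zpow_one, pow_succ']
      have e2 : qPow (-1) * qPow 1 = 1 := by rw [← qPow_add]; simp [qPow]
      have e3 : aPow (-2) = aPow 2 * aPow (-4) := by rw [← aPow_add]; rfl
      have e4 : (q : ℤ[T;T⁻¹]) = qPow 1 := by simp [qPow]
      -- The start has S = -A² - A⁻² = A²(q⁻¹ - 1), hence S = A^(2 - a₁) q⁻¹ (1 + q[a₁]_q - q) after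
      -- the first braid. This explains the exceptional first entry.
      refine hs.trans ?_
      rw [Partial.sideBracket_start, Partial.nestedBracket_start]
      simp only [Even.zero, if_true, zero_add, numerator, entry, e1, e4]
      rw [aPow_add, circleValue_eq, e3, sub_zero]
      linear_combination aPow (-a 1) * aPow 2 * (-qPow_neg_one + (1 - qNum (a 1)) * e2)
    · refine hn.trans ?_
      rw [Partial.nestedBracket_start]
      simp [numerator]
  | succ n ih =>
    obtain ⟨hw, z, e, o, heo, hz, hs, hn⟩ := ih
    have hl := ell_succ a (n + 1)
    by_cases hev : Even n
    · have hev' : ¬ Even (n + 1) := by simpa [Nat.even_add_one] using hev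
      have hev2 : Even (n + 2) := by simpa [Nat.even_add] using hev
      obtain ⟨hw', hs', hn'⟩ := Partial.iterate_twistLeft hw (a (n + 2))
      have hb : braids a (n + 1 + 1) = Partial.twistLeft^[a (n + 2)] (braids a (n + 1)) := by
        rw [braids, if_neg hev']
      rw [hb]
      simp only [hev, hev', if_true, if_false] at hs hn ⊢
      refine ⟨hw', z + a (n + 2), e + a (n + 2), o, by push_cast [hl]; linarith, ?_, ?_, ?_⟩
      · have : z + a (n + 2) + ell a (n + 1 + 1) = z + ell a (n + 1) + 2 * a (n + 2) := by
          push_cast [hl]; ring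
        rw [this]
        exact hz.add (even_two_mul _)
      · rw [hs', hs, show z + a (n + 2) + 2 = a (n + 2) + (z + 2) by ring,
          show -1 - (e + a (n + 2)) = -a (n + 2) + (-1 - e) by ring,
          aPow_add (a (n + 2)), qPow_add]
        ring
      · have hent : entry a (n + 2) = qNum (a (n + 2)) * qPow (-(ell a (n + 2) : ℤ)) := by
          rw [entry, if_neg (by omega), if_pos hev2]
          rfl
        -- Factoring q^o out of the new nested bracket leaves the exponent -(a (n+2) + e + o), which
        -- is that of the even entry.
        have e1 : qPow (1 - a (n + 2)) * qPow (-1 - e) = qPow o * qPow (-(ell a (n + 2) : ℤ)) := by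
          rw [← qPow_add, ← qPow_add]
          congr 1
          push_cast [hl]
          linarith
        have e2 : aPow (-2) * aPow 2 = 1 := by rw [← aPow_add]; simp [aPow]
        rw [hn', hs, hn, numerator, hent, aPow_add z 2, aPow_add z]
        linear_combination aPow (a (n + 2)) * aPow z * qNum (a (n + 2)) *
          numerator (entry a) (n + 1) * (e1 + qPow (1 - a (n + 2)) * qPow (-1 - e) * e2)
    · have hev' : Even (n + 1) := by simpa [Nat.even_add_one] using hev
      have hev2 : ¬ Even (n + 2) := by simpa [Nat.even_add] using hev
      obtain ⟨hw', hn', hs'⟩ := Partial.iterate_twistMiddle hw (a (n + 2))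
      have hb : braids a (n + 1 + 1) = Partial.twistMiddle^[a (n + 2)] (braids a (n + 1)) := by
        rw [braids, if_pos hev']
      rw [hb]
      simp only [hev, hev', if_true, if_false] at hs hn ⊢
      refine ⟨hw', z - a (n + 2), e, o + a (n + 2), by push_cast [hl]; linarith, ?_, ?_, ?_⟩
      · have : z - a (n + 2) + ell a (n + 1 + 1) = z + ell a (n + 1) := by
          push_cast [hl]; ring
        rwa [this]
      · have hent : entry a (n + 2) = qNum (a (n + 2)) * qPow ((ell a (n + 1) : ℤ) + 1) := by
          rw [entry, if_neg (by omega), if_neg hev2]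
          rfl
        -- Factoring q^(-1-e) out of the new side bracket leaves o + e + 1, the exponent of the odd
        -- entry.
        have e1 : qPow o = qPow (-1 - e) * qPow ((ell a (n + 1) : ℤ) + 1) := by
          rw [← qPow_add]
          congr 1
          linarith
        rw [hs', hs, hn, numerator, hent, show z - a (n + 2) + 2 = -a (n + 2) + (z + 2) by ring,
          aPow_add (-a (n + 2)), aPow_add z, e1]
        ring
      · rw [hn', hn, show z - a (n + 2) = -a (n + 2) + z by ring, aPow_add, qPow_add]
        ring

/-! ### The leading term -/

/-- Positive powers of q are negative powers of t, so only the constant term reaches exponent 0. -/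
theorem polynomial_aeval_q_coeff (p : Polynomial ℤ) :
    (Polynomial.aeval (q : ℤ[T;T⁻¹]) p).coeff 0 = p.coeff 0 ∧
      ∀ e, 0 < e → (Polynomial.aeval (q : ℤ[T;T⁻¹]) p).coeff e = 0 := by
  induction p using Polynomial.induction_on' with
  | add p r hp hr =>
    refine ⟨by simp [hp.1, hr.1], fun e he => by simp [hp.2 e he, hr.2 e he]⟩
  | monomial k c =>
    have h : Polynomial.aeval (q : ℤ[T;T⁻¹]) (Polynomial.monomial k c) =
        AddMonoidAlgebra.single (-4 * (k : ℤ)) (c * (((-1 : ℤˣ) ^ (k : ℤ) : ℤˣ) : ℤ)) := by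
      rw [Polynomial.aeval_monomial, ← qPow_natCast, qPow_eq, ← mul_assoc,
        show algebraMap ℤ ℤ[T;T⁻¹] c = C c from rfl, ← map_mul, single_eq_C_mul_T]
    rw [h]
    refine ⟨?_, fun e he => ?_⟩
    · rcases Nat.eq_zero_or_pos k with rfl | hk
      · rw [AddMonoidAlgebra.coeff_single]
        simp
      · rw [Polynomial.coeff_monomial, if_neg hk.ne', AddMonoidAlgebra.coeff_single,
          Finsupp.single_apply, if_neg (by omega)]
    · rw [AddMonoidAlgebra.coeff_single, Finsupp.single_apply, if_neg (by omega)]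

theorem exists_qNum_eq (k : ℕ) (hk : 0 < k) :
    ∃ p : Polynomial ℤ, qNum k = Polynomial.aeval (q : ℤ[T;T⁻¹]) p ∧ p.coeff 0 = 1 := by
  refine ⟨∑ i ∈ Finset.range k, Polynomial.X ^ i, by simp [qNum], ?_⟩
  simp [Polynomial.coeff_X_pow, hk]

/-- The numerator, multiplied by a power of `q`, is a polynomial in `q` with constant term `1`. -/
theorem exists_numerator_eq (a : ℕ → ℕ) (n : ℕ) (ha : ∀ i, 1 ≤ i → i ≤ n → 0 < a i) :
    ∃ p : Polynomial ℤ, (if Odd n then numerator (entry a) n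
        else (q : ℤ[T;T⁻¹]) ^ ell a n * numerator (entry a) n) =
      Polynomial.aeval (q : ℤ[T;T⁻¹]) p ∧ p.coeff 0 = 1 := by
  induction n using Nat.twoStepInduction with
  | zero => exact ⟨1, by simp [numerator, ell], by simp⟩
  | one =>
    obtain ⟨p, hp, hp0⟩ := exists_qNum_eq (a 1 + 1) (by omega)
    exact ⟨p - Polynomial.X, by simp [numerator, entry, hp], by simp [hp0]⟩
  | more n ih1 ih2 =>
    obtain ⟨p1, hp1, hp10⟩ := ih1 fun i hi hi' => ha i hi (by omega)
    obtain ⟨p2, hp2, hp20⟩ := ih2 fun i hi hi' => ha i hi (by omega)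
    have hpos := ha (n + 2) (by omega) le_rfl
    obtain ⟨p3, hp3, hp30⟩ := exists_qNum_eq _ hpos
    have hl : ell a (n + 2) = ell a (n + 1) + a (n + 2) := ell_succ a (n + 1)
    have hl' := ell_succ a n
    by_cases hodd : Odd n
    · have h1 : ¬ Odd (n + 1) := by simpa [Nat.odd_add_one] using hodd
      have h2 : Odd (n + 2) := by simpa [Nat.odd_add] using hodd
      rw [if_pos hodd] at hp1
      rw [if_neg h1] at hp2
      -- The factor q^(ℓ_{n+1}) of the entry is what normalises the even numerator `p2`; the
      -- remaining q kills the constant term of that summand.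
      refine ⟨p3 * Polynomial.X * p2 + p1, ?_, by simp [Polynomial.mul_coeff_zero, hp10]⟩
      have hent : entry a (n + 2) = qNum (a (n + 2)) * qPow ((ell a (n + 1) : ℤ) + 1) := by
        rw [entry, if_neg (by omega), if_neg (by simpa using h2)]
        rfl
      rw [if_pos h2, numerator, hent, map_add, map_mul, map_mul, ← hp1, ← hp2, ← hp3,
        Polynomial.aeval_X, qPow_add, qPow_natCast, show qPow 1 = q by simp [qPow]]
      ring
    · have h1 : Odd (n + 1) := by simpa [Nat.odd_add_one] using hodd
      have h2 : ¬ Odd (n + 2) := by simpa [Nat.odd_add] using hodd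
      rw [if_neg hodd] at hp1
      rw [if_pos h1] at hp2
      -- The normalising power cancels against the entry, and exceeds the one for n by a (n+1) + a
      -- (n+2). This is positive, so the constant term comes from `p3 * p2`.
      refine ⟨p3 * p2 + Polynomial.X ^ (a (n + 2) + a (n + 1)) * p1, ?_, ?_⟩
      · have hent : entry a (n + 2) = qNum (a (n + 2)) * qPow (-(ell a (n + 2) : ℤ)) := by
          rw [entry, if_neg (by omega), if_pos (by simpa using h2)]
          rfl
        have e : (q : ℤ[T;T⁻¹]) ^ ell a (n + 2) * qPow (-(ell a (n + 2) : ℤ)) = 1 := by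
          rw [← qPow_natCast, ← qPow_add]
          simp [qPow]
        have e' : (q : ℤ[T;T⁻¹]) ^ ell a (n + 2) = q ^ (a (n + 2) + a (n + 1)) * q ^ ell a n := by
          rw [← pow_add]
          congr 1
          omega
        rw [if_neg h2, numerator, hent, map_add, map_mul, map_mul, ← hp1, ← hp2, ← hp3,
          Polynomial.aeval_X_pow]
        linear_combination qNum (a (n + 2)) * numerator (entry a) (n + 1) * e +
          numerator (entry a) n * e'
      · simp [Polynomial.mul_coeff_zero, hp20, hp30, Polynomial.coeff_X_pow]
        omega

theorem isLeadingTerm_mul_aeval (p : Polynomial ℤ) (hp : p.coeff 0 = 1) (δ : ℤˣ) (j : ℤ) :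
    IsLeadingTerm (C (δ : ℤ) * T j * Polynomial.aeval (q : ℤ[T;T⁻¹]) p) (δ : ℤ) j := by
  obtain ⟨h0, h⟩ := polynomial_aeval_q_coeff p
  have key : ∀ e, (C (δ : ℤ) * T j * Polynomial.aeval (q : ℤ[T;T⁻¹]) p).coeff e =
      δ * (Polynomial.aeval (q : ℤ[T;T⁻¹]) p).coeff (e - j) := by
    intro e
    rw [← single_eq_C_mul_T, AddMonoidAlgebra.coeff_single_mul_apply]
    congr 2
    ring
  refine ⟨δ.ne_zero, ?_, fun e he => ?_⟩
  · rw [key, sub_self, h0, hp, mul_one]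
  · rw [key, h _ (by omega), mul_zero]

/-! ### The writhe -/

/-- Every crossing sign is odd. -/
theorem even_writhe_add_length (cs : List Crossing) (o : ℕ → Bool) :
    Even ((cs.map fun c => c.sign o).sum + cs.length) := by
  induction cs with
  | nil => simp
  | cons c cs ih =>
    have hc : Even (c.sign o + 1) := by
      rw [Crossing.sign]
      split_ifs <;> decide
    have : ((c :: cs).map fun c => c.sign o).sum + ((c :: cs).length : ℤ) =
        (c.sign o + 1) + ((cs.map fun c => c.sign o).sum + cs.length) := by
      simp only [List.map_cons, List.sum_cons, List.length_cons]
      push_cast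
      ring
    rw [this]
    exact hc.add ih

theorem length_crossings_braids (a : ℕ → ℕ) (n : ℕ) :
    (braids a n).crossings.length = ell a n := by
  have key : ∀ f : Partial → Partial, (∀ P, (f P).crossings.length = P.crossings.length + 1) →
      ∀ k P, (f^[k] P).crossings.length = P.crossings.length + k := by
    intro f hf k P
    induction k with
    | zero => rfl
    | succ k ih => rw [Function.iterate_succ_apply', hf, ih, add_assoc]
  induction n with
  | zero => simp [braids, Partial.start, ell]
  | succ n ih =>
    rw [braids, ell_succ, ← ih]
    apply key
    intro P
    split_ifs <;> rfl

/-! ### Orientations -/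

namespace Partial

/-- `o` is compatible with the two maxima and with all crossings of a partial diagram. -/
def IsOriented (P : Partial) (o : ℕ → Bool) : Prop :=
  o 0 ≠ o 1 ∧ o 2 ≠ o 3 ∧ ∀ c ∈ P.crossings, o c.nw = o c.se ∧ o c.ne = o c.sw

/-- The lower ends of the partial diagram can be given the directions `b1, b2, b3, b4`. -/
def Admits (P : Partial) (b1 b2 b3 b4 : Bool) : Prop :=
  ∃ o, P.IsOriented o ∧ o P.s1 = b1 ∧ o P.s2 = b2 ∧ o P.s3 = b3 ∧ o P.s4 = b4

/-- The four lower ends can be matched in pairs in such a way that any choice of opposite directions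
on each pair comes from an orientation. -/
def Paired (P : Partial) : Prop :=
  (∀ b c, P.Admits b (!b) c (!c)) ∨ (∀ b c, P.Admits b c (!b) (!c)) ∨
    (∀ b c, P.Admits b c (!c) (!b))

theorem paired_start : start.Paired := by
  refine .inl fun b c => ⟨fun x => if x = 0 then b else if x = 1 then !b else if x = 2 then c
    else !c, ?_⟩
  simp [IsOriented, start]

variable {P : Partial}

theorem WellFormed.exists_extension (h : P.WellFormed) {o : ℕ → Bool} (ho : P.IsOriented o)
    (b c : Bool) : ∃ o', P.IsOriented o' ∧ (∀ x < P.next, o' x = o x) ∧ o' P.next = b ∧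
      o' (P.next + 1) = c := by
  have h4 := h.four_le
  have key : ∀ x < P.next,
      (if x = P.next then b else if x = P.next + 1 then c else o x) = o x := by
    intro x hx
    rw [if_neg (by omega), if_neg (by omega)]
  refine ⟨fun x => if x = P.next then b else if x = P.next + 1 then c else o x, ?_, key, by simp,
    by simp⟩
  refine ⟨?_, ?_, fun d hd => ?_⟩
  · dsimp only
    rw [key 0 (by omega), key 1 (by omega)]
    exact ho.1
  · dsimp only
    rw [key 2 (by omega), key 3 (by omega)]
    exact ho.2.1
  · obtain ⟨h1, h2, h3, h4⟩ := h.crossings d hd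
    dsimp only
    rw [key _ h1, key _ h2, key _ h3, key _ h4]
    exact ho.2.2 d hd

theorem Admits.twistMiddle (h : P.WellFormed) {b1 b2 b3 b4 : Bool} (hP : P.Admits b1 b2 b3 b4) :
    P.twistMiddle.Admits b1 b3 b2 b4 := by
  obtain ⟨o, ho, h1, h2, h3, h4⟩ := hP
  obtain ⟨o', ho', he, hb, hc⟩ := h.exists_extension ho b3 b2
  refine ⟨o', ⟨ho'.1, ho'.2.1, fun c hc' => ?_⟩, by simp [Partial.twistMiddle, he _ h.lt1, h1], hb,
    hc, by simp [Partial.twistMiddle, he _ h.lt4, h4]⟩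
  rcases List.mem_cons.1 hc' with rfl | hc'
  · simp [he _ h.lt2, he _ h.lt3, hb, hc, h2, h3]
  · exact ho'.2.2 c hc'

theorem Admits.twistLeft (h : P.WellFormed) {b1 b2 b3 b4 : Bool} (hP : P.Admits b1 b2 b3 b4) :
    P.twistLeft.Admits b2 b1 b3 b4 := by
  obtain ⟨o, ho, h1, h2, h3, h4⟩ := hP
  obtain ⟨o', ho', he, hb, hc⟩ := h.exists_extension ho b2 b1
  refine ⟨o', ⟨ho'.1, ho'.2.1, fun c hc' => ?_⟩, hb, hc,
    by simp [Partial.twistLeft, he _ h.lt3, h3], by simp [Partial.twistLeft, he _ h.lt4, h4]⟩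
  rcases List.mem_cons.1 hc' with rfl | hc'
  · simp [he _ h.lt1, he _ h.lt2, hb, hc, h1, h2]
  · exact ho'.2.2 c hc'

/-- A crossing transposes two adjacent ends and thereby permutes the three matchings. -/
theorem Paired.twistMiddle (h : P.WellFormed) (hP : P.Paired) : P.twistMiddle.Paired := by
  rcases hP with hP | hP | hP
  · exact .inr (.inl fun b c => (hP b c).twistMiddle h)
  · exact .inl fun b c => (hP b c).twistMiddle h
  · refine .inr (.inr fun b c => ?_)
    simpa using (hP b (!c)).twistMiddle h

theorem Paired.twistLeft (h : P.WellFormed) (hP : P.Paired) : P.twistLeft.Paired := by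
  rcases hP with hP | hP | hP
  · refine .inl fun b c => ?_
    simpa using (hP (!b) c).twistLeft h
  · exact .inr (.inr fun b c => (hP c b).twistLeft h)
  · exact .inr (.inl fun b c => (hP c b).twistLeft h)

theorem Paired.exists_side (hP : P.Paired) : ∃ b c, P.Admits b (!b) c (!c) := by
  rcases hP with hP | hP | hP
  · exact ⟨true, true, hP _ _⟩
  · exact ⟨true, false, hP true false⟩
  · exact ⟨true, true, hP true false⟩

theorem Paired.exists_nested (hP : P.Paired) : ∃ b c, P.Admits b c (!c) (!b) := by
  rcases hP with hP | hP | hP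
  · exact ⟨true, false, hP true true⟩
  · exact ⟨true, true, hP true true⟩
  · exact ⟨true, true, hP _ _⟩

end Partial

theorem paired_braids (a : ℕ → ℕ) (n : ℕ) : (braids a n).WellFormed ∧ (braids a n).Paired := by
  have key : ∀ f : Partial → Partial,
      (∀ P, P.WellFormed ∧ P.Paired → (f P).WellFormed ∧ (f P).Paired) →
      ∀ k P, P.WellFormed ∧ P.Paired → (f^[k] P).WellFormed ∧ (f^[k] P).Paired := by
    intro f hf k P hP
    induction k with
    | zero => exact hP
    | succ k ih =>
      rw [Function.iterate_succ_apply']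
      exact hf _ ih
  induction n with
  | zero => exact ⟨Partial.wellFormed_start, Partial.paired_start⟩
  | succ n ih =>
    rw [braids]
    refine key _ (fun P hP => ?_) _ _ ih
    split_ifs
    · exact ⟨hP.1.twistMiddle, hP.2.twistMiddle hP.1⟩
    · exact ⟨hP.1.twistLeft, hP.2.twistLeft hP.1⟩

theorem exists_isOrientation (a : ℕ → ℕ) (n : ℕ) :
    ∃ o : ℕ → Bool, (twoBridge a n).IsOrientation o := by
  have hP := (paired_braids a n).2
  by_cases hn : Odd n
  · obtain ⟨b, c, o, ho, h1, h2, h3, h4⟩ := hP.exists_side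
    refine ⟨o, ?_, ho.2.2⟩
    simp [twoBridge, hn, ho.1, ho.2.1, h1, h2, h3, h4]
  · obtain ⟨b, c, o, ho, h1, h2, h3, h4⟩ := hP.exists_nested
    refine ⟨o, ?_, ho.2.2⟩
    simp [twoBridge, hn, ho.1, ho.2.1, h1, h2, h3, h4]

/-! ### The Jones polynomial -/

theorem bracket_twoBridge (a : ℕ → ℕ) (n : ℕ) :
    (twoBridge a n).bracket =
      if Odd n then (braids a n).sideBracket else (braids a n).nestedBracket := by
  by_cases hn : Odd n <;> simp [LinkDiagram.bracket, twoBridge, hn, Partial.sideBracket,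
    Partial.nestedBracket]

/-- The bracket is the numerator up to a sign and a power of `t^{1/4}`, whose parity is known. -/
theorem exists_bracket_eq (a : ℕ → ℕ) (n : ℕ) (hn : 1 ≤ n) :
    ∃ y z : ℤ, Even (y + ell a n) ∧ (twoBridge a n).bracket = aPow y * qPow z *
      (if Odd n then numerator (entry a) n
        else (q : ℤ[T;T⁻¹]) ^ ell a n * numerator (entry a) n) := by
  obtain ⟨n, rfl⟩ : ∃ k, n = k + 1 := ⟨n - 1, by omega⟩
  obtain ⟨-, z, e, o, -, hz, hs, hn⟩ := braids_bracket a n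
  rw [bracket_twoBridge]
  by_cases hev : Even n
  · have hodd : Odd (n + 1) := hev.add_one
    simp only [hodd, hev, if_true] at hs ⊢
    refine ⟨z + 2, -1 - e, ?_, hs⟩
    rw [add_right_comm]
    exact hz.add even_two
  · have hodd : ¬ Odd (n + 1) := by simpa [Nat.odd_add_one] using hev
    simp only [hodd, hev, if_false] at hn ⊢
    refine ⟨z, o - ell a (n + 1), hz, ?_⟩
    have e : qPow o = qPow (o - ell a (n + 1)) * qPow (ell a (n + 1)) := by
      rw [← qPow_add, sub_add_cancel]
    rw [hn, ← qPow_natCast, e]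
    ring

theorem jones_eq (a : ℕ → ℕ) (n : ℕ) (hn : 1 ≤ n) (o : ℕ → Bool) :
    ∃ (δ : ℤˣ) (j : ℤ), (twoBridge a n).jones o = C (δ : ℤ) * T (2 * j) *
      (if Odd n then numerator (entry a) n
        else (q : ℤ[T;T⁻¹]) ^ ell a n * numerator (entry a) n) := by
  obtain ⟨y, z, hy, hb⟩ := exists_bracket_eq a n hn
  have hw : Even ((twoBridge a n).writhe o + ell a n) := by
    have := even_writhe_add_length (braids a n).crossings o
    rwa [length_crossings_braids] at this
  set w := (twoBridge a n).writhe o with hw'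
  -- In units of t^{1/4}, the writhe factor contributes 3w, and the bracket contributes -y from A^y
  -- and -4z from q^z. Both w and y have the parity of the crossing number.
  obtain ⟨j, hj⟩ : ∃ j, 3 * w - y - 4 * z = 2 * j := by
    obtain ⟨r, hr⟩ := hw
    obtain ⟨s, hs⟩ := hy
    exact ⟨3 * r - s - ell a n - 2 * z, by linarith⟩
  refine ⟨(-1) ^ (-w) * (-1) ^ z, j, ?_⟩
  have hpow : (((-A ^ 3) ^ (-w) : ℤ[T;T⁻¹]ˣ) : ℤ[T;T⁻¹]) =
      C (((-1 : ℤˣ) ^ (-w) : ℤˣ) : ℤ) * T (3 * w) := by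
    rw [neg_zpow_eq, ← zpow_natCast, ← zpow_mul]
    congr 1
    refine (aPow_eq _).trans ?_
    congr 1
    push_cast
    ring
  rw [LinkDiagram.jones, ← hw', hpow, hb, aPow_eq, qPow_eq, Units.val_mul, map_mul, ← hj,
    show 3 * w - y - 4 * z = 3 * w + -y + -4 * z by ring, T_add, T_add]
  ring

end TwoBridge

end

theorem theorem7p4 (n : ℕ) (hn : 1 ≤ n) (a : ℕ → ℕ) (ha : ∀ i, 1 ≤ i → i ≤ n → 0 < a i) :
    (∃ o : ℕ → Bool, (twoBridge a n).IsOrientation o) ∧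
    ∀ o : ℕ → Bool, (twoBridge a n).IsOrientation o →
      ∃ (δ : ℤˣ) (j : ℤ),
        IsLeadingTerm ((twoBridge a n).jones o) (δ : ℤ) (2 * j) ∧
        (twoBridge a n).jones o =
          C (δ : ℤ) * T (2 * j) *
            (if Odd n then numerator (entry a) n
             else (q : ℤ[T;T⁻¹]) ^ ell a n * numerator (entry a) n) := by
  refine ⟨exists_isOrientation a n, fun o _ => ?_⟩
  obtain ⟨δ, j, h⟩ := jones_eq a n hn o
  obtain ⟨p, hp, hp0⟩ := exists_numerator_eq a n ha
  refine ⟨δ, j, ?_, h⟩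
  rw [h, hp]
  exact isLeadingTerm_mul_aeval p hp0 δ (2 * j)
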